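/- Let $\Sigma=\{0,1\}$. For $x,y\in\Sigma^*$ let $\langle x,y\rangle = x_1x_1x_2x_2\cdots x_{|x|}x_{|x|}\,01\,y_1y_1y_2y_2\cdots y_{|y|}y_{|y|}\in\Sigma^*$. An equivalence relation $R$ on $\Sigma^*$ is identified with the language $L_R=\{\langle x,y\rangle : (x,y)\in R\}$. Let $\mathrm{NPEq}$ be the class of equivalence relations $R$ on $\Sigma^*$ such that $L_R\in\mathrm{NP}$, i.e. $L_R$ is decided by a nondeterministic Turing machine in polynomial time. For equivalence relations $R,S$ on $\Sigma^*$, a polynomial-time kernel reduction from $R$ to $S$ is a polynomial-time computable function $f\colon\Sigma^*\to\Sigma^*$ such that $(x,y)\in R\iff (f(x),f(y))\in S$ for all $x,y\in\Sigma^*$. An equivalence relation $R$ on $\Sigma^*$ is $\mathrm{NPEq}$-complete if $R\in\mathrm{NPEq}$ and every equivalence relation in $\mathrm{NPEq}$ has a polynomial-time kernel reduction to $R$. Corollary. If an equivalence relation $R$ on $\Sigma^*$ is $\mathrm{NPEq}$-complete, then $L_R$ is $\mathrm{NP}$-complete under polynomial-time many-one reductions. -/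

import Mathlib

namespace KernelRed

/-- Binary strings. -/
abbrev Str : Type := List Bool

/-- The pairwise encoding `x₁x₁x₂x₂⋯xₙxₙ 01 y₁y₁y₂y₂⋯yₘyₘ` of two binary strings. -/
def pair (x y : Str) : Str :=
  x.flatMap (fun b => [b, b]) ++ [false, true] ++ y.flatMap (fun b => [b, b])

/-- The language over the binary alphabet induced by an equivalence relation on binary strings. -/
def inducedLang (R : Setoid Str) : Language Bool :=
  {z | ∃ x y : Str, R x y ∧ z = pair x y}

/-- The class FP: functions on binary strings computed by a deterministic (multi-stack) Turing
machine in polynomial time. -/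
def PolyTime (f : Str → Str) : Prop :=
  Nonempty (Turing.TM2ComputableInPolyTime (id : Str → List Bool) (id : Str → List Bool) f)

/-- A nondeterministic Turing machine. This is the nondeterministic version of Mathlib's
deterministic machine model `Turing.FinTM2`: finitely many stacks, finite alphabets, finitely many
labels and internal states, and for each label a finite list of statements, one of which is chosen
whenever a step is made at that label. -/
structure NTM where
  /-- index type of the stacks -/
  K : Type
  [decEqK : DecidableEq K]
  [finK : Fintype K]
  /-- the stack alphabets -/
  Γ : K → Type
  [finΓ : ∀ k, Fintype (Γ k)]
  /-- the input stack -/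
  k₀ : K
  /-- how the symbols 0 and 1 are written on the input stack -/
  inp : Bool ↪ Γ k₀
  /-- labels -/
  Λ : Type
  [finΛ : Fintype Λ]
  /-- the label at which the computation starts -/
  main : Λ
  /-- internal states -/
  σ : Type
  [finσ : Fintype σ]
  /-- the internal state in which the computation starts -/
  start : σ
  /-- the internal states in which a halted computation accepts -/
  accept : Set σ
  /-- the program: the statements among which the machine can choose at each label -/
  prog : Λ → List (Turing.TM2.Stmt Γ Λ σ)

attribute [instance] NTM.decEqK NTM.finK NTM.finΓ NTM.finΛ NTM.finσ

namespace NTM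

/-- Configurations: the current label (`none` if halted), internal state, and stack contents. -/
abbrev Cfg (N : NTM) : Type := Turing.TM2.Cfg N.Γ N.Λ N.σ

/-- The initial configuration on input `x`: `x` is on the input stack with its first symbol on top,
and all the other stacks are empty. -/
def init (N : NTM) (x : Str) : N.Cfg where
  l := some N.main
  var := N.start
  stk := Function.update (fun _ => []) N.k₀ (x.map N.inp)

/-- `N.Step c d`: the machine can move from `c` to `d` in one step. -/
def Step (N : NTM) (c d : N.Cfg) : Prop :=
  ∃ l : N.Λ, c.l = some l ∧ ∃ q ∈ N.prog l, d = Turing.TM2.stepAux q c.var c.stk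

/-- `N.ReachesIn n c d`: some computation path of exactly `n` steps leads from `c` to `d`. -/
def ReachesIn (N : NTM) : ℕ → N.Cfg → N.Cfg → Prop
  | 0, c, d => c = d
  | n + 1, c, d => ∃ e, N.Step c e ∧ N.ReachesIn n e d

/-- On input `x` the machine halts in time `t`: no computation path has more than `t` steps. -/
def HaltsInTime (N : NTM) (x : Str) (t : ℕ) : Prop :=
  ∀ (n : ℕ) (d : N.Cfg), N.ReachesIn n (N.init x) d → n ≤ t

/-- The machine accepts `x`: some computation path halts in an accepting state. -/
def Accepts (N : NTM) (x : Str) : Prop :=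
  ∃ (n : ℕ) (d : N.Cfg), N.ReachesIn n (N.init x) d ∧ d.l = none ∧ d.var ∈ N.accept

end NTM

/-- The class NP: languages decided by a nondeterministic Turing machine in polynomial time. -/
def InNP (L : Language Bool) : Prop :=
  ∃ (N : NTM) (p : Polynomial ℕ), ∀ x : Str,
    N.HaltsInTime x (p.eval x.length) ∧ (x ∈ L ↔ N.Accepts x)

/-- Polynomial-time many-one reducibility of languages. -/
def ManyOneReduces (A B : Language Bool) : Prop :=
  ∃ f : Str → Str, PolyTime f ∧ ∀ w : Str, w ∈ A ↔ f w ∈ B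

/-- NP-completeness (under polynomial-time many-one reductions). -/
def NPComplete (L : Language Bool) : Prop :=
  InNP L ∧ ∀ A : Language Bool, InNP A → ManyOneReduces A L

/-- The class NPEq: equivalence relations whose induced language is in NP. -/
def InNPEq (R : Setoid Str) : Prop := InNP (inducedLang R)

/-- Polynomial-time kernel reducibility of equivalence relations. -/
def KernelReduces (R S : Setoid Str) : Prop :=
  ∃ f : Str → Str, PolyTime f ∧ ∀ x y : Str, R x y ↔ S (f x) (f y)

/-- NPEq-completeness (under polynomial-time kernel reductions). -/
def NPEqComplete (S : Setoid Str) : Prop :=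
  InNPEq S ∧ ∀ R : Setoid Str, InNPEq R → KernelReduces R S

end KernelRed

/-! Given `A` in NP, let `headSetoid A` identify `0w` with `1w` exactly when `w ∈ A`, and nothing
else. Its classes have at most two elements, so it is an equivalence relation for every `A`. If its
language is in NP, completeness of `R` gives a kernel reduction `f`, and `w ∈ A` iff `R` relates `f
(0w)` and `f (1w)`, so `w ↦ pair (f (0w)) (f (1w))` is a many-one reduction of `A` to the language
of `R`.

Two machine constructions carry this. `inNP_inducedLang_headSetoid` builds a nondeterministic
machine that parses a pair deterministically and runs the machine for `A` only on a common tail.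
`polyTime_pair_cons` builds a deterministic machine that runs the machine for `f` twice; its time
bound needs the fact that outputs are polynomially long. Both embed the given machine by `liftStmt`.
-/

namespace KernelRed

open Turing Turing.TM2 Function

/-! ### Embedding a machine into one with more stacks, labels and registers -/

section Lift

variable {K₁ K₂ : Type} {Γ₁ : K₁ → Type} {Γ₂ : K₂ → Type} {Λ₁ Λ₂ σ₁ σ₂ : Type}

/-- The stack alphabets of a machine whose stacks are the disjoint union of two families. -/
abbrev SumAlphabet (Γ₁ : K₁ → Type) (Γ₂ : K₂ → Type) : K₁ ⊕ K₂ → Type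
  | .inl k => Γ₁ k
  | .inr k => Γ₂ k

/-- Stack contents of a machine whose stacks are the disjoint union of two families. -/
def join (S₁ : ∀ k, List (Γ₁ k)) (S₂ : ∀ k, List (Γ₂ k)) :
    ∀ k : K₁ ⊕ K₂, List (SumAlphabet Γ₁ Γ₂ k)
  | .inl k => S₁ k
  | .inr k => S₂ k

@[simp]
theorem join_inl (S₁ : ∀ k, List (Γ₁ k)) (S₂ : ∀ k, List (Γ₂ k)) (k : K₁) :
    join S₁ S₂ (.inl k) = S₁ k := rfl

@[simp]
theorem join_inr (S₁ : ∀ k, List (Γ₁ k)) (S₂ : ∀ k, List (Γ₂ k)) (k : K₂) :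
    join S₁ S₂ (.inr k) = S₂ k := rfl

variable [DecidableEq K₁] [DecidableEq K₂]

@[simp]
theorem update_join_inl (S₁ : ∀ k, List (Γ₁ k)) (S₂ : ∀ k, List (Γ₂ k)) (k : K₁)
    (s : List (Γ₁ k)) : update (join S₁ S₂) (.inl k) s = join (update S₁ k s) S₂ := by
  funext j
  rcases j with j | j
  · rcases eq_or_ne j k with rfl | h
    · simp
    · simp [h]
  · simp

@[simp]
theorem update_join_inr (S₁ : ∀ k, List (Γ₁ k)) (S₂ : ∀ k, List (Γ₂ k)) (k : K₂)
    (s : List (Γ₂ k)) : update (join S₁ S₂) (.inr k) s = join S₁ (update S₂ k s) := by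
  funext j
  rcases j with j | j
  · simp
  · rcases eq_or_ne j k with rfl | h
    · simp
    · simp [h]

/-- A statement of a machine, as a statement of a machine with additional stacks, labels and
registers; instead of halting it goes on with `h`. -/
def liftStmt (h : Stmt (SumAlphabet Γ₁ Γ₂) (Λ₁ ⊕ Λ₂) (σ₁ × σ₂)) :
    Stmt Γ₂ Λ₂ σ₂ → Stmt (SumAlphabet Γ₁ Γ₂) (Λ₁ ⊕ Λ₂) (σ₁ × σ₂)
  | .push k f q => .push (.inr k) (fun s => f s.2) (liftStmt h q)
  | .peek k f q => .peek (.inr k) (fun s a => (s.1, f s.2 a)) (liftStmt h q)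
  | .pop k f q => .pop (.inr k) (fun s a => (s.1, f s.2 a)) (liftStmt h q)
  | .load f q => .load (fun s => (s.1, f s.2)) (liftStmt h q)
  | .branch f q₁ q₂ => .branch (fun s => f s.2) (liftStmt h q₁) (liftStmt h q₂)
  | .goto f => .goto fun s => .inr (f s.2)
  | .halt => h

/-- The configuration of the larger machine that corresponds to a configuration. -/
def liftCfg (h : Stmt (SumAlphabet Γ₁ Γ₂) (Λ₁ ⊕ Λ₂) (σ₁ × σ₂)) (t : σ₁) (S₁ : ∀ k, List (Γ₁ k)) :
    Cfg Γ₂ Λ₂ σ₂ → Cfg (SumAlphabet Γ₁ Γ₂) (Λ₁ ⊕ Λ₂) (σ₁ × σ₂)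
  | ⟨some l, v, S₂⟩ => ⟨some (.inr l), (t, v), join S₁ S₂⟩
  | ⟨none, v, S₂⟩ => stepAux h (t, v) (join S₁ S₂)

/-- The continuation `h` runs within the very step in which the small machine halts. This is why
`liftCfg` sends a halted configuration to the result of `h`, and why the simulation is step for
step. -/
theorem stepAux_liftStmt (h : Stmt (SumAlphabet Γ₁ Γ₂) (Λ₁ ⊕ Λ₂) (σ₁ × σ₂)) (t : σ₁)
    (S₁ : ∀ k, List (Γ₁ k)) (q : Stmt Γ₂ Λ₂ σ₂) (v : σ₂) (S₂ : ∀ k, List (Γ₂ k)) :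
    stepAux (liftStmt h q) (t, v) (join S₁ S₂) = liftCfg h t S₁ (stepAux q v S₂) := by
  induction q generalizing v S₂ with
  | push k f q ih => simp only [liftStmt, stepAux, update_join_inr, join_inr]; exact ih _ _
  | peek k f q ih => exact ih _ _
  | pop k f q ih => simp only [liftStmt, stepAux, update_join_inr, join_inr]; exact ih _ _
  | load f q ih => exact ih _ _
  | branch f q₁ q₂ ih₁ ih₂ =>
    simp only [liftStmt, stepAux]
    cases f v
    · exact ih₂ _ _
    · exact ih₁ _ _
  | goto f => rfl
  | halt => rfl

end Lift

/-! ### Growth of stacks and monotonicity of time bounds -/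

/-- The number of push commands in a statement. -/
def pushes {K : Type} {Γ : K → Type} {Λ σ : Type} : Stmt Γ Λ σ → ℕ
  | .push _ _ q => pushes q + 1
  | .peek _ _ q => pushes q
  | .pop _ _ q => pushes q
  | .load _ q => pushes q
  | .branch _ q₁ q₂ => pushes q₁ + pushes q₂
  | .goto _ => 0
  | .halt => 0

/-- A statement contains no loop, so each push in it is executed at most once. Adding up both
branches is wasteful but suffices. -/
theorem length_stepAux_le {K : Type} [DecidableEq K] {Γ : K → Type} {Λ σ : Type}
    (q : Stmt Γ Λ σ) (v : σ) (S : ∀ k, List (Γ k)) (k : K) :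
    ((stepAux q v S).stk k).length ≤ (S k).length + pushes q := by
  induction q generalizing v S with
  | push j f q ih =>
    refine (ih v _).trans ?_
    rcases eq_or_ne k j with rfl | h
    · simp [pushes]; omega
    · simp [pushes, h]
  | peek j f q ih => exact ih _ _
  | pop j f q ih =>
    refine (ih _ _).trans ?_
    rcases eq_or_ne k j with rfl | h
    · simp [pushes]
    · simp [pushes, h]
  | load f q ih => exact ih _ _
  | branch f q₁ q₂ ih₁ ih₂ =>
    have h₁ := ih₁ v S
    have h₂ := ih₂ v S
    simp only [stepAux, pushes]
    cases f v <;> simp only [cond_true, cond_false] <;> omega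
  | goto f => simp [pushes]
  | halt => simp [pushes]

theorem eval_le_eval (p : Polynomial ℕ) {m n : ℕ} (h : m ≤ n) : p.eval m ≤ p.eval n := by
  rw [Polynomial.eval_eq_sum, Polynomial.eval_eq_sum]
  exact Finset.sum_le_sum fun i _ => Nat.mul_le_mul_left _ (Nat.pow_le_pow_left h i)

/-! ### The pair encoding -/

/-- Every symbol of a string written twice. -/
def double (x : Str) : Str := x.flatMap fun b => [b, b]

@[simp]
theorem double_nil : double [] = [] := rfl

@[simp]
theorem double_cons (b : Bool) (x : Str) : double (b :: x) = b :: b :: double x := rfl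

theorem pair_eq (x y : Str) : pair x y = double x ++ false :: true :: double y := by
  simp [pair, double]

theorem double_injective : Injective double
  | [], [], _ => rfl
  | [], _ :: _, h => by simp at h
  | _ :: _, [], h => by simp at h
  | a :: x, b :: y, h => by
    simp only [double_cons, List.cons.injEq] at h
    rw [h.1, double_injective h.2.2]

/-- Read in blocks of two, the separator `01` is the first block with unequal symbols, so it marks
the end of the first component. -/
theorem pair_injective {x y x' y' : Str} (h : pair x y = pair x' y') : x = x' ∧ y = y' := by
  simp only [pair_eq] at h
  induction x generalizing x' with
  | nil =>
    cases x' with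
    | nil => simpa [double_injective.eq_iff] using h
    | cons b x' => simp at h; grind
  | cons a x ih =>
    cases x' with
    | nil => simp at h; grind
    | cons b x' =>
      simp only [double_cons, List.cons_append, List.cons.injEq] at h
      obtain ⟨rfl, rfl⟩ := ih h.2.2
      exact ⟨by rw [h.1], rfl⟩

theorem pair_mem_inducedLang (R : Setoid Str) (x y : Str) :
    pair x y ∈ inducedLang R ↔ R x y := by
  constructor
  · rintro ⟨x', y', h, e⟩
    obtain ⟨rfl, rfl⟩ := pair_injective e
    exact h
  · exact fun h => ⟨x, y, h, rfl⟩

/-! ### The equivalence relation attached to a language -/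

/-- The equivalence relation that identifies two distinct strings if they differ in the first
symbol only and the rest is in `A`. -/
def headSetoid (A : Language Bool) : Setoid Str where
  r x y := x = y ∨ ∃ a b, ∃ w ∈ A, x = a :: w ∧ y = b :: w
  iseqv :=
    { refl := fun _ => .inl rfl
      symm := by
        rintro x y (rfl | ⟨a, b, w, hw, rfl, rfl⟩)
        · exact .inl rfl
        · exact .inr ⟨b, a, w, hw, rfl, rfl⟩
      trans := by
        rintro x y z (rfl | ⟨a, b, w, hw, rfl, rfl⟩) (rfl | ⟨a', b', w', hw', h, rfl⟩)
        · exact .inl rfl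
        · exact .inr ⟨a', b', w', hw', h, rfl⟩
        · exact .inr ⟨a, b, w, hw, rfl, rfl⟩
        · obtain ⟨rfl, rfl⟩ := List.cons.inj h
          exact .inr ⟨a, b', w, hw, rfl, rfl⟩ }

theorem headSetoid_iff (A : Language Bool) (x y : Str) :
    headSetoid A x y ↔ x = y ∨ ∃ a b, ∃ w ∈ A, x = a :: w ∧ y = b :: w := Iff.rfl

theorem headSetoid_cons {A : Language Bool} {a b : Bool} (h : a ≠ b) (w : Str) :
    headSetoid A (a :: w) (b :: w) ↔ w ∈ A := by
  rw [headSetoid_iff]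
  constructor
  · rintro (h' | ⟨a', b', w', hw, h₁, -⟩)
    · exact (h (List.cons.inj h').1).elim
    · exact (List.cons.inj h₁).2 ▸ hw
  · exact fun hw => .inr ⟨a, b, w, hw, rfl, rfl⟩

theorem headSetoid_length {A : Language Bool} {x y : Str} (h : headSetoid A x y) :
    x.length = y.length := by
  rcases h with rfl | ⟨a, b, w, -, rfl, rfl⟩ <;> simp

/-- Related strings have equal length and agree after the first symbol, so a mismatch can only sit
at the head. This justifies rejecting when symbols remain in front of a mismatch. -/
theorem headSetoid_append {A : Language Bool} {a b : Bool} (h : a ≠ b) {x y w : Str}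
    (hr : headSetoid A (x ++ a :: w) (y ++ b :: w)) : x = [] ∧ y = [] := by
  have hl := headSetoid_length hr
  simp only [List.length_append, List.length_cons] at hl
  rcases hr with hr | ⟨c, d, u, -, h₁, h₂⟩
  · have := (List.append_inj hr (by omega)).2
    exact (h (List.cons.inj this).1).elim
  · cases x with
    | nil => exact ⟨rfl, List.length_eq_zero_iff.1 (by simpa using hl.symm)⟩
    | cons _ x =>
      cases y with
      | nil => simp at hl
      | cons _ y =>
        simp only [List.cons_append, List.cons.injEq] at h₁ h₂
        have := (List.append_inj (h₁.2.trans h₂.2.symm) (by simp at hl; omega)).2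
        exact (h (List.cons.inj this).1).elim

/-! ### Time-bounded decision from an arbitrary configuration -/

namespace NTM

/-- All computation paths from `c` have at most `t` steps, and one of them accepts if and only if
`Q` holds. -/
def Decides (N : NTM) (c : N.Cfg) (t : ℕ) (Q : Prop) : Prop :=
  (∀ n d, N.ReachesIn n c d → n ≤ t) ∧
    (Q ↔ ∃ n d, N.ReachesIn n c d ∧ d.l = none ∧ d.var ∈ N.accept)

variable {N : NTM}

theorem Decides.mono {c : N.Cfg} {t t' : ℕ} {Q Q' : Prop} (h : N.Decides c t Q) (ht : t ≤ t')
    (hQ : Q' ↔ Q) : N.Decides c t' Q' :=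
  ⟨fun n d hd => (h.1 n d hd).trans ht, hQ.trans h.2⟩

theorem Decides.halted {c : N.Cfg} {Q : Prop} (t : ℕ) (hc : c.l = none)
    (hQ : Q ↔ c.var ∈ N.accept) : N.Decides c t Q := by
  have key : ∀ n d, N.ReachesIn n c d → n = 0 ∧ c = d := by
    rintro (_ | n) d h
    · exact ⟨rfl, h⟩
    · obtain ⟨e, ⟨l, hl, -⟩, -⟩ := h
      simp [hc] at hl
  refine ⟨fun n d h => by simp [(key n d h).1], hQ.trans ⟨fun h => ⟨0, c, rfl, hc, h⟩, ?_⟩⟩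
  rintro ⟨n, d, h, -, hd⟩
  exact (key n d h).2 ▸ hd

/-- With a single available statement there is one successor, so the verdict is inherited from it.
This covers the deterministic parsing phase. -/
theorem Decides.step {l : N.Λ} {v : N.σ} {S : ∀ k, List (N.Γ k)} {q : Stmt N.Γ N.Λ N.σ}
    (hq : N.prog l = [q]) {t : ℕ} {Q : Prop} (h : N.Decides (stepAux q v S) t Q) :
    N.Decides ⟨some l, v, S⟩ (t + 1) Q := by
  have key : ∀ e, N.Step ⟨some l, v, S⟩ e ↔ e = stepAux q v S := by
    intro e
    simp [Step, hq]
  refine ⟨?_, h.2.trans ⟨?_, ?_⟩⟩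
  · rintro (_ | n) d hd
    · omega
    · obtain ⟨e, he, hd⟩ := hd
      rw [key] at he
      subst he
      have := h.1 n d hd
      omega
  · rintro ⟨n, d, hd, hacc⟩
    exact ⟨n + 1, d, ⟨_, (key _).2 rfl, hd⟩, hacc⟩
  · rintro ⟨_ | n, d, hd, hacc⟩
    · cases hd
      simp at hacc
    · obtain ⟨e, he, hd⟩ := hd
      rw [key] at he
      subst he
      exact ⟨n, d, hd, hacc⟩

end NTM

/-! ### A nondeterministic machine for the language of `headSetoid A` -/

/-- The stacks for parsing an encoded pair: the input, and the two components. -/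
inductive ParseStack
  | inp | xs | ys
  deriving DecidableEq

instance : Fintype ParseStack := ⟨{.inp, .xs, .ys}, fun k => by cases k <;> simp⟩

/-- The phases of parsing an encoded pair and comparing its components. -/
inductive ParseLabel
  | fst | snd | compare
  deriving DecidableEq

instance : Fintype ParseLabel := ⟨{.fst, .snd, .compare}, fun l => by cases l <;> simp⟩

/-- The contents of the stacks for parsing. -/
@[simp]
def parseStk (z x y : Str) : ParseStack → Str
  | .inp => z
  | .xs => x
  | .ys => y

@[simp]
theorem update_parseStk_inp (z x y s : Str) :
    update (parseStk z x y) .inp s = parseStk s x y := by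
  funext k; cases k <;> rfl

@[simp]
theorem update_parseStk_xs (z x y s : Str) :
    update (parseStk z x y) .xs s = parseStk z s y := by
  funext k; cases k <;> rfl

@[simp]
theorem update_parseStk_ys (z x y s : Str) :
    update (parseStk z x y) .ys s = parseStk z x s := by
  funext k; cases k <;> rfl

section

variable (N : NTM)

/-- The stack alphabets of `headNTM N`. -/
abbrev HeadAlphabet : ParseStack ⊕ N.K → Type := SumAlphabet (fun _ => Bool) N.Γ

/-- The registers of `headNTM N`: the two symbols read last, and the state of `N`. -/
abbrev HeadState : Type := (Option Bool × Option Bool) × N.σ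

/-- Statements of `headNTM N`. -/
abbrev HeadStmt : Type := Stmt (HeadAlphabet N) (ParseLabel ⊕ N.Λ) (HeadState N)

/-- Configurations of `headNTM N`. -/
abbrev HeadCfg : Type := Cfg (HeadAlphabet N) (ParseLabel ⊕ N.Λ) (HeadState N)

/-- Read a symbol from each of two stacks into the registers. -/
@[simp]
def readTwo (j k : ParseStack) (q : HeadStmt N) : HeadStmt N :=
  .pop (.inl j) (fun s a => ((a, s.1.2), s.2)) <| .pop (.inl k) (fun s a => ((s.1.1, a), s.2)) q

/-- Set the registers. -/
@[simp]
def setRegs (t : Option Bool × Option Bool) (q : HeadStmt N) : HeadStmt N :=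
  .load (fun s => (t, s.2)) q

/-- Halt and reject. -/
@[simp]
def reject : HeadStmt N := setRegs N (some true, none) .halt

/-- Branch if both registers are empty. -/
@[simp]
def ifEmpty (q₁ q₂ : HeadStmt N) : HeadStmt N := .branch (fun s => decide (s.1 = (none, none))) q₁ q₂

/-- Branch if the registers hold the same symbol. -/
@[simp]
def ifSame (q₁ q₂ : HeadStmt N) : HeadStmt N :=
  .branch (fun s => s.1.1.isSome && decide (s.1.1 = s.1.2)) q₁ q₂

/-- The program that parses an encoded pair and compares its components. -/
@[simp]
def parseProg : ParseLabel → HeadStmt N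
  | .fst => readTwo N .inp .inp <|
      ifSame N (.push (.inl .xs) (fun s => s.1.1.getD false) <| .goto fun _ => .inl .fst) <|
      .branch (fun s => decide (s.1 = (some false, some true)))
        (.goto fun _ => .inl .snd) (reject N)
  | .snd => readTwo N .inp .inp <|
      ifSame N (.push (.inl .ys) (fun s => s.1.1.getD false) <| .goto fun _ => .inl .snd) <|
      ifEmpty N (.goto fun _ => .inl .compare) (reject N)
  -- Parsing leaves both components reversed, so comparison runs from their ends. Matched symbols go
  -- to the input stack of `N`, which thus holds the common suffix in its original order when a
  -- mismatch is met.
  | .compare => readTwo N .xs .ys <|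
      ifSame N (.push (.inr N.k₀) (fun s => N.inp (s.1.1.getD false)) <|
        .goto fun _ => .inl .compare) <|
      ifEmpty N .halt <|
      .branch (fun s => s.1.1.isSome && s.1.2.isSome)
        (readTwo N .xs .ys <|
          ifEmpty N (setRegs N (some true, some true) <| .goto fun _ => .inr N.main) (reject N))
        (reject N)

instance (k : ParseStack ⊕ N.K) : Fintype (HeadAlphabet N k) :=
  match k with
  | .inl _ => inferInstanceAs (Fintype Bool)
  | .inr k => N.finΓ k

/-- If `N` decides `A`, this machine decides the language of `headSetoid A`. -/
def headNTM : NTM where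
  K := ParseStack ⊕ N.K
  Γ := HeadAlphabet N
  k₀ := .inl .inp
  inp := Embedding.refl Bool
  Λ := ParseLabel ⊕ N.Λ
  main := .inl .fst
  σ := HeadState N
  start := ((none, none), N.start)
  -- The registers record the verdict: both empty when the components are equal, `(true, true)`
  -- throughout a run of `N`, and `(true, none)` after a rejection.
  accept := {s | s.1 = (none, none) ∨ s.1 = (some true, some true) ∧ s.2 ∈ N.accept}
  prog := Sum.elim (fun l => [parseProg N l]) fun l => (N.prog l).map (liftStmt .halt)

/-- The configuration of `headNTM N` that corresponds to a configuration of `N`. -/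
def headCfg (c : N.Cfg) : HeadCfg N :=
  ⟨c.l.map .inr, ((some true, some true), c.var), join (parseStk [] [] []) c.stk⟩

/-- The configurations of `headNTM N` during parsing. -/
def parseCfg (l : ParseLabel) (t : Option Bool × Option Bool) (z x y w : Str) :
    HeadCfg N :=
  ⟨some (.inl l), (t, N.start), join (parseStk z x y) (update (fun _ => []) N.k₀ (w.map N.inp))⟩

variable {N}

theorem liftCfg_halt (c : N.Cfg) :
    liftCfg (.halt : HeadStmt N) (some true, some true) (parseStk [] [] []) c = headCfg N c := by
  obtain ⟨_ | l, v, S⟩ := c <;> rfl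

/-- Both directions are needed: the time bound concerns all paths of the large machine, and
acceptance needs paths of `N` to carry over. -/
theorem step_headCfg (c : N.Cfg) (d : HeadCfg N) :
    (headNTM N).Step (headCfg N c) d ↔ ∃ e, N.Step c e ∧ d = headCfg N e := by
  obtain ⟨_ | l, v, S⟩ := c
  · constructor
    · rintro ⟨l, hl, -⟩
      cases hl
    · rintro ⟨e, ⟨l, hl, -⟩, -⟩
      cases hl
  · constructor
    · rintro ⟨l', hl, q', hq', rfl⟩
      cases hl
      obtain ⟨q, hq, rfl⟩ := List.mem_map.1 hq'
      exact ⟨_, ⟨l, rfl, q, hq, rfl⟩, (stepAux_liftStmt ..).trans (liftCfg_halt _)⟩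
    · rintro ⟨e, ⟨l', hl, q, hq, rfl⟩, rfl⟩
      cases hl
      exact ⟨.inr l, rfl, _, List.mem_map_of_mem hq,
        ((stepAux_liftStmt ..).trans (liftCfg_halt _)).symm⟩

theorem reachesIn_headCfg (n : ℕ) (c : N.Cfg) (d : HeadCfg N) :
    (headNTM N).ReachesIn n (headCfg N c) d ↔ ∃ e, N.ReachesIn n c e ∧ d = headCfg N e := by
  induction n generalizing c with
  | zero => exact ⟨fun h => ⟨c, rfl, h.symm⟩, fun ⟨e, he, h⟩ => by cases he; exact h.symm⟩
  | succ n ih =>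
    constructor
    · rintro ⟨e', he', h⟩
      obtain ⟨e, he, rfl⟩ := (step_headCfg c e').1 he'
      obtain ⟨d, hd, rfl⟩ := (ih e).1 h
      exact ⟨d, ⟨e, he, hd⟩, rfl⟩
    · rintro ⟨d, ⟨e, he, hd⟩, rfl⟩
      exact ⟨_, (step_headCfg c _).2 ⟨e, he, rfl⟩, (ih e).2 ⟨d, hd, rfl⟩⟩

theorem decides_headCfg {c : N.Cfg} {t : ℕ} {Q : Prop} (h : N.Decides c t Q) :
    (headNTM N).Decides (headCfg N c) t Q := by
  refine ⟨fun n d hd => ?_, h.2.trans ⟨?_, ?_⟩⟩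
  · obtain ⟨e, he, -⟩ := (reachesIn_headCfg n c d).1 hd
    exact h.1 n e he
  · rintro ⟨n, d, hd, hl, hv⟩
    refine ⟨n, _, (reachesIn_headCfg n c _).2 ⟨d, hd, rfl⟩, ?_, .inr ⟨rfl, hv⟩⟩
    exact Option.map_eq_none_iff.2 hl
  · rintro ⟨n, d, hd, hl, hv⟩
    obtain ⟨e, he, rfl⟩ := (reachesIn_headCfg n c d).1 hd
    refine ⟨n, e, he, Option.map_eq_none_iff.1 hl, ?_⟩
    rcases hv with hv | hv
    · cases hv
    · exact hv.2

/-- The configuration reached in one step from `parseCfg N l r z x y w`. -/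
def parseStep (N : NTM) (l : ParseLabel) (r : Option Bool × Option Bool) (z x y w : Str) :
    HeadCfg N :=
  stepAux (parseProg N l) (r, N.start)
    (join (parseStk z x y) (update (fun _ => []) N.k₀ (w.map N.inp)))

variable {l : ParseLabel} {r : Option Bool × Option Bool} {z x y w : Str}

theorem decides_parse {c : HeadCfg N} {t : ℕ} {Q : Prop} (hc : parseStep N l r z x y w = c)
    (h : (headNTM N).Decides c t Q) :
    (headNTM N).Decides (parseCfg N l r z x y w) (t + 1) Q := by
  subst hc
  exact .step rfl h

theorem decides_parse_reject (t : ℕ) {Q : Prop} (hl : (parseStep N l r z x y w).l = none)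
    (hv : (parseStep N l r z x y w).var.1 = (some true, none)) (hQ : ¬Q) :
    (headNTM N).Decides (parseCfg N l r z x y w) (t + 1) Q := by
  refine decides_parse rfl (.halted t hl (iff_of_false hQ ?_))
  rintro (h | h)
  · cases hv.symm.trans h
  · cases hv.symm.trans h.1

section

variable {A : Language Bool} {m T : ℕ}
    (hN : ∀ w : Str, w.length ≤ m → N.Decides (N.init w) T (w ∈ A))
include hN

/-- The invariant is that `w` is the suffix already matched, with `x` and `y` the reversed unmatched
parts. Each match moves one symbol from `x` to `w`, so `hm` persists and ensures that `hN` applies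
to the final `w`. -/
theorem decides_compare (hm : x.length + w.length ≤ m) :
    (headNTM N).Decides (parseCfg N .compare r [] x y w) (T + x.length + 1)
      (headSetoid A (x.reverse ++ w) (y.reverse ++ w)) := by
  induction x generalizing r y w with
  | nil =>
    cases y with
    | nil =>
      exact decides_parse rfl (.halted _ rfl (iff_of_true (.inl rfl) (.inl rfl)))
    | cons b y =>
      refine decides_parse_reject _ ?_ ?_ fun h => ?_
      · simp [parseStep]
      · simp [parseStep]
      · have := headSetoid_length h
        simp at this
        omega
  | cons a x ih =>
    cases y with
    | nil =>
      refine decides_parse_reject _ ?_ ?_ fun h => ?_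
      · simp [parseStep]
      · simp [parseStep]
      · have := headSetoid_length h
        simp at this
        omega
    | cons b y =>
      rcases eq_or_ne a b with rfl | hab
      · refine decides_parse ?_ <| .mono (ih (r := (some a, some a)) (y := y) (w := a :: w)
          (by simp at hm ⊢; omega)) (by simp) (by simp)
        simp [parseStep, parseCfg]
      · by_cases hxy : x = [] ∧ y = []
        · obtain ⟨rfl, rfl⟩ := hxy
          refine decides_parse ?_ <| .mono (decides_headCfg (hN w (by simp at hm; omega)))
            (by simp) (by simpa using headSetoid_cons hab w)
          simp [parseStep, hab, headCfg, NTM.init]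
        · refine decides_parse_reject _ ?_ ?_ fun h => hxy ?_
          · rcases x with _ | ⟨_, x⟩ <;> rcases y with _ | ⟨_, y⟩ <;> simp at hxy <;>
            simp [parseStep, hab]
          · rcases x with _ | ⟨_, x⟩ <;> rcases y with _ | ⟨_, y⟩ <;> simp at hxy <;>
            simp [parseStep, hab]
          · simpa using headSetoid_append hab (x := x.reverse) (y := y.reverse) (by simpa using h)

theorem decides_snd (hm : x.length ≤ m) :
    (headNTM N).Decides (parseCfg N .snd r z x y []) (T + x.length + z.length + 2)
      (∃ u, z = double u ∧ headSetoid A x.reverse (y.reverse ++ u)) := by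
  induction z using List.twoStepInduction generalizing r y with
  | nil =>
    refine decides_parse ?_ <| .mono (decides_compare hN (r := (none, none)) (x := x) (y := y)
      (w := []) (by simpa using hm)) (by simp) ?_
    · simp [parseStep, parseCfg]
    · constructor
      · rintro ⟨_ | ⟨b, u⟩, h, hr⟩
        · simpa using hr
        · simp at h
      · exact fun h => ⟨[], rfl, by simpa using h⟩
  | singleton b =>
    refine decides_parse_reject _ ?_ ?_ ?_
    · simp [parseStep]
    · simp [parseStep]
    · rintro ⟨_ | ⟨c, u⟩, h, -⟩ <;> simp at h
  | cons_cons a b z ih _ =>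
    rcases eq_or_ne a b with rfl | hab
    · refine decides_parse ?_ <| .mono (ih (r := (some a, some a)) (y := a :: y)) (by simp) ?_
      · simp [parseStep, parseCfg]
      · constructor
        · rintro ⟨_ | ⟨c, u⟩, h, hr⟩
          · simp at h
          · simp at h
            obtain ⟨rfl, -, rfl⟩ := h
            exact ⟨u, rfl, by simpa using hr⟩
        · rintro ⟨u, rfl, hr⟩
          exact ⟨a :: u, rfl, by simpa using hr⟩
    · refine decides_parse_reject _ ?_ ?_ ?_
      · simp [parseStep, hab]
      · simp [parseStep, hab]
      · rintro ⟨_ | ⟨c, u⟩, h, -⟩ <;> simp at h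
        exact hab (h.1.trans h.2.1.symm)

/-- A block of two input symbols pays for one parsing step and one later comparison step. The
constant 3 pays for the last step of each of the three phases. -/
theorem decides_fst (hm : x.length + z.length ≤ m) :
    (headNTM N).Decides (parseCfg N .fst r z x [] []) (T + x.length + z.length + 3)
      (∃ u v, z = pair u v ∧ headSetoid A (x.reverse ++ u) v) := by
  induction z using List.twoStepInduction generalizing r x with
  | nil =>
    refine decides_parse_reject _ ?_ ?_ ?_
    · simp [parseStep]
    · simp [parseStep]
    · rintro ⟨_ | ⟨c, u⟩, v, h, -⟩ <;> simp [pair_eq] at h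
  | singleton b =>
    refine decides_parse_reject _ ?_ ?_ ?_
    · simp [parseStep]
    · simp [parseStep]
    · rintro ⟨_ | ⟨c, u⟩, v, h, -⟩ <;> simp [pair_eq] at h
  | cons_cons a b z ih _ =>
    rcases eq_or_ne a b with rfl | hab
    · refine decides_parse ?_ <| .mono (ih (r := (some a, some a)) (x := a :: x)
        (by simp at hm ⊢; omega)) (by simp; omega) ?_
      · simp [parseStep, parseCfg]
      · constructor
        · rintro ⟨_ | ⟨c, u⟩, v, h, hr⟩
          · simp [pair_eq] at h
            grind
          · simp [pair_eq] at h
            obtain ⟨rfl, -, rfl⟩ := h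
            exact ⟨u, v, pair_eq u v ▸ rfl, by simpa using hr⟩
        · rintro ⟨u, v, rfl, hr⟩
          exact ⟨a :: u, v, by simp [pair_eq], by simpa using hr⟩
    · by_cases h01 : a = false ∧ b = true
      · obtain ⟨rfl, rfl⟩ := h01
        refine decides_parse ?_ <| .mono (decides_snd hN (r := (some false, some true)) (x := x)
          (y := []) (z := z) (by simp at hm; omega)) (by simp; omega) ?_
        · simp [parseStep, parseCfg]
        · constructor
          · rintro ⟨_ | ⟨c, u⟩, v, h, hr⟩
            · simp [pair_eq] at h
              exact ⟨v, h, by simpa using hr⟩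
            · simp [pair_eq] at h
              grind
          · rintro ⟨u, rfl, hr⟩
            exact ⟨[], u, by simp [pair_eq], by simpa using hr⟩
      · refine decides_parse_reject _ ?_ ?_ ?_
        · simp [parseStep, hab, h01]
        · simp [parseStep, hab, h01]
        · rintro ⟨_ | ⟨c, u⟩, v, h, -⟩ <;> simp [pair_eq] at h
          · exact h01 ⟨h.1, h.2.1⟩
          · exact hab (h.1.trans h.2.1.symm)

end

end

theorem inNP_inducedLang_headSetoid {A : Language Bool} (hA : InNP A) :
    InNP (inducedLang (headSetoid A)) := by
  obtain ⟨N, p, hN⟩ := hA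
  refine ⟨headNTM N, p + Polynomial.X + 3, fun z => ?_⟩
  have hi : (headNTM N).init z = parseCfg N .fst (none, none) z [] [] [] := by
    refine congrArg (TM2.Cfg.mk _ _) ?_
    funext k
    rcases k with (_ | _ | _) | k
    · exact (update_self ..).trans (List.map_id _)
    · rfl
    · rfl
    · simp only [List.map_nil, update_eq_self, join_inr]
      rfl
  -- `N` is run on a string no longer than `z`, so by monotonicity `p.eval z.length` bounds its time
  -- uniformly.
  have h := decides_fst (N := N) (A := A) (m := z.length) (T := p.eval z.length)
    (r := (none, none)) (x := []) (z := z)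
    (fun w hw => .mono (t := p.eval w.length) ⟨(hN w).1, (hN w).2⟩ (eval_le_eval p hw) Iff.rfl)
    (by simp)
  rw [← hi] at h
  refine ⟨?_, ?_⟩
  · intro n d hd
    simpa using h.1 n d hd
  · refine Iff.trans ?_ h.2
    exact ⟨fun ⟨x, y, hr, e⟩ => ⟨x, y, e, hr⟩, fun ⟨x, y, e, hr⟩ => ⟨x, y, hr, e⟩⟩

/-! ### Deterministic runs and the length of their output -/

/-- The machine gets from `c` to `d` in at most `t` steps. -/
def Evaluates (M : FinTM2) (c : M.Cfg) (t : ℕ) (d : M.Cfg) : Prop :=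
  ∃ n ≤ t, (flip bind M.step)^[n] (some c) = some d

theorem iterate_flip_bind_none {α : Type} (f : α → Option α) (n : ℕ) :
    (flip bind f)^[n] none = none := by
  induction n with
  | zero => rfl
  | succ n ih => exact ih

section

variable {M : FinTM2}

theorem Evaluates.step {l : M.Λ} {v : M.σ} {S : ∀ k, List (M.Γ k)} {t : ℕ} {d : M.Cfg}
    (h : Evaluates M (stepAux (M.m l) v S) t d) : Evaluates M ⟨some l, v, S⟩ (t + 1) d := by
  obtain ⟨n, hn, h⟩ := h
  exact ⟨n + 1, by omega, h⟩

theorem Evaluates.mono {c : M.Cfg} {t t' : ℕ} {d : M.Cfg} (h : Evaluates M c t d) (ht : t ≤ t') :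
    Evaluates M c t' d :=
  let ⟨n, hn, h⟩ := h
  ⟨n, hn.trans ht, h⟩

theorem initList_eq (s : List (M.Γ M.k₀)) :
    initList M s = ⟨some M.main, M.initialState, update (fun _ => []) M.k₀ s⟩ := by
  refine congrArg (TM2.Cfg.mk _ _) ?_
  funext k
  by_cases h : k = M.k₀
  · subst h
    simp
  · simp [h]

theorem haltList_eq (s : List (M.Γ M.k₁)) :
    haltList M s = ⟨none, M.initialState, update (fun _ => []) M.k₁ s⟩ := by
  refine congrArg (TM2.Cfg.mk _ _) ?_
  funext k
  by_cases h : k = M.k₁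
  · subst h
    simp
  · simp [h]

instance : Fintype M.Λ := M.ΛFin

theorem length_iterate_step_le (n : ℕ) {c d : M.Cfg} (k : M.K)
    (h : (flip bind M.step)^[n] (some c) = some d) :
    (d.stk k).length ≤ (c.stk k).length + n * ∑ l, pushes (M.m l) := by
  induction n generalizing c with
  | zero => cases h; simp
  | succ n ih =>
    obtain ⟨_ | l, v, S⟩ := c
    · exact absurd ((iterate_flip_bind_none M.step n).symm.trans h) (by simp)
    · have h₁ := ih h
      have h₂ := length_stepAux_le (M.m l) v S k
      have h₃ : pushes (M.m l) ≤ ∑ l, pushes (M.m l) :=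
        Finset.single_le_sum (f := fun l => pushes (M.m l)) (fun _ _ => Nat.zero_le _)
          (Finset.mem_univ l)
      rw [Nat.succ_mul]
      change _ ≤ (S k).length + _
      omega

end

/-! ### A deterministic machine that runs `M` on both one-symbol extensions -/

/-- The additional stacks of the machine that runs a given machine twice: the input, the output,
two copies of the input, and a stack for reversing. -/
inductive TwiceStack
  | inp | out | tmp | copy (b : Bool)
  deriving DecidableEq

instance : Fintype TwiceStack :=
  ⟨{.inp, .out, .tmp, .copy true, .copy false}, fun k => by rcases k with _ | _ | _ | _ | _ <;> simp⟩

/-- The phases around the two runs of a given machine. -/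
inductive TwiceLabel
  | split | feed (b : Bool) | drain (b : Bool) | emit (b : Bool)
  deriving DecidableEq

instance : Fintype TwiceLabel :=
  ⟨{.split, .feed true, .feed false, .drain true, .drain false, .emit true, .emit false},
    fun k => by rcases k with _ | (_ | _) | (_ | _) | (_ | _) <;> simp⟩

/-- The contents of the additional stacks. -/
@[simp]
def twiceStk (z o u x y : Str) : TwiceStack → Str
  | .inp => z
  | .out => o
  | .tmp => u
  | .copy true => x
  | .copy false => y

@[simp]
theorem update_twiceStk_inp (z o u x y s : Str) :
    update (twiceStk z o u x y) .inp s = twiceStk s o u x y := by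
  funext k; rcases k with _ | _ | _ | _ | _ <;> rfl

@[simp]
theorem update_twiceStk_out (z o u x y s : Str) :
    update (twiceStk z o u x y) .out s = twiceStk z s u x y := by
  funext k; rcases k with _ | _ | _ | _ | _ <;> rfl

@[simp]
theorem update_twiceStk_tmp (z o u x y s : Str) :
    update (twiceStk z o u x y) .tmp s = twiceStk z o s x y := by
  funext k; rcases k with _ | _ | _ | _ | _ <;> rfl

@[simp]
theorem update_twiceStk_copy_true (z o u x y s : Str) :
    update (twiceStk z o u x y) (.copy true) s = twiceStk z o u s y := by
  funext k; rcases k with _ | _ | _ | _ | _ <;> rfl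

@[simp]
theorem update_twiceStk_copy_false (z o u x y s : Str) :
    update (twiceStk z o u x y) (.copy false) s = twiceStk z o u x s := by
  funext k; rcases k with _ | _ | _ | _ | _ <;> rfl

section

variable (M : FinTM2)

/-- The stack alphabets of `twiceTM`. -/
abbrev TwiceAlphabet : TwiceStack ⊕ M.K → Type := SumAlphabet (fun _ => Bool) M.Γ

/-- The states of `twiceTM`: which run it is, the symbol read last, and the state of `M`. -/
abbrev TwiceState : Type := (Bool × Option Bool) × M.σ

/-- Statements of `twiceTM`. -/
abbrev TwiceStmt : Type := Stmt (TwiceAlphabet M) (TwiceLabel ⊕ M.Λ) (TwiceState M)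

/-- Configurations of `twiceTM`. -/
abbrev TwiceCfg : Type := Cfg (TwiceAlphabet M) (TwiceLabel ⊕ M.Λ) (TwiceState M)

/-- Pop a symbol into the register, and branch on whether there was one. -/
@[simp]
def popCase (k : TwiceStack) (q₁ q₂ : TwiceStmt M) : TwiceStmt M :=
  .pop (.inl k) (fun s a => ((s.1.1, a), s.2)) <| .branch (fun s => s.1.2.isSome) q₁ q₂

/-- Push the symbol in the register. -/
@[simp]
def pushReg (k : TwiceStack) (q : TwiceStmt M) : TwiceStmt M :=
  .push (.inl k) (fun s => s.1.2.getD false) q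

variable (ei : M.Γ M.k₀ ≃ Bool) (eo : M.Γ M.k₁ ≃ Bool)

/-- The program around the two runs of `M`. -/
@[simp]
def twiceProg : TwiceLabel → TwiceStmt M
  | .split => popCase M .inp
      (pushReg M (.copy true) <| pushReg M (.copy false) <| .goto fun _ => .inl .split)
      (.goto fun _ => .inl (.feed true))
  | .feed b => popCase M (.copy b)
      (.push (.inr M.k₀) (fun s => ei.symm (s.1.2.getD false)) <| .goto fun _ => .inl (.feed b))
      (.push (.inr M.k₀) (fun _ => ei.symm b) <|
        .load (fun s => ((b, none), s.2)) <| .goto fun _ => .inr M.main)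
  | .drain b => .pop (.inr M.k₁) (fun s a => ((s.1.1, a.map eo), s.2)) <|
      .branch (fun s => s.1.2.isSome) (pushReg M .tmp <| .goto fun _ => .inl (.drain b))
        (.goto fun _ => .inl (.emit b))
  | .emit b => popCase M .tmp
      (pushReg M .out <| pushReg M .out <| .goto fun _ => .inl (.emit b)) <|
      match b with
      | true => .push (.inl .out) (fun _ => true) <| .push (.inl .out) (fun _ => false) <|
          .goto fun _ => .inl (.feed false)
      -- `haltList` requires the initial internal state at the end, so the registers are reset.
      | false => .load (fun s => ((true, none), s.2)) .halt

/-- What is done when a run of `M` has halted. -/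
def afterRun : TwiceStmt M := .goto fun s => .inl (.drain s.1.1)

/-- If `M` computes `f`, this machine computes `w ↦ pair (f (false :: w)) (f (true :: w))`. -/
def twiceTM : FinTM2 where
  K := TwiceStack ⊕ M.K
  kDecidableEq := inferInstance
  kFin := letI := M.kFin; inferInstance
  k₀ := .inl .inp
  k₁ := .inl .out
  Γ := TwiceAlphabet M
  Λ := TwiceLabel ⊕ M.Λ
  main := .inl .split
  ΛFin := letI := M.ΛFin; inferInstance
  σ := TwiceState M
  initialState := ((true, none), M.initialState)
  σFin := letI := M.σFin; inferInstance
  Γk₀Fin := inferInstanceAs (Fintype Bool)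
  m := Sum.elim (twiceProg M ei eo) fun l => liftStmt (afterRun M) (M.m l)

variable {M}

/-- The configurations of `twiceTM` outside of the runs of `M`. -/
def twiceCfg (l : TwiceLabel) (r : Bool × Option Bool) (z o u x y : Str)
    (S : ∀ k, List (M.Γ k)) : TwiceCfg M :=
  ⟨some (.inl l), (r, M.initialState), join (twiceStk z o u x y) S⟩

variable {l : TwiceLabel} {r : Bool × Option Bool} {z o u x y : Str} {S : ∀ k, List (M.Γ k)}
  {t : ℕ} {d : TwiceCfg M}

theorem evaluates_twice {c : TwiceCfg M} (hc : stepAux (twiceProg M ei eo l)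
      (r, M.initialState) (join (twiceStk z o u x y) S) = c)
    (h : Evaluates (twiceTM M ei eo) c t d) :
    Evaluates (twiceTM M ei eo) (twiceCfg l r z o u x y S) (t + 1) d := by
  subst hc
  exact .step h

/-- Halting and the jump to draining share one step, so a run of `M` costs exactly its own `n`
steps. -/
theorem evaluates_liftCfg (b : Bool × Option Bool) (S : TwiceStack → Str) (n : ℕ) {c e : M.Cfg}
    (hn : (flip bind M.step)^[n] (some c) = some e)
    (h : Evaluates (twiceTM M ei eo) (liftCfg (afterRun M) b S e) t d) :
    Evaluates (twiceTM M ei eo) (liftCfg (afterRun M) b S c) (t + n) d := by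
  induction n generalizing c with
  | zero => cases hn; exact h
  | succ n ih =>
    obtain ⟨_ | l, v, S₂⟩ := c
    · exact absurd ((iterate_flip_bind_none M.step n).symm.trans hn) (by simp)
    · have h₁ := ih hn
      rw [← stepAux_liftStmt] at h₁
      exact .step h₁

theorem evaluates_split
    (h : ∀ r, Evaluates (twiceTM M ei eo)
      (twiceCfg (.feed true) r [] o u (z.reverse ++ x) (z.reverse ++ y) S) t d) :
    Evaluates (twiceTM M ei eo) (twiceCfg .split r z o u x y S) (t + z.length + 1) d := by
  induction z generalizing r x y with
  | nil => exact evaluates_twice ei eo (by simp [twiceCfg]) (h (r.1, none))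
  | cons a z ih =>
    exact evaluates_twice ei eo (by simp [twiceCfg])
      (ih (r := (r.1, some a)) (x := a :: x) (y := a :: y) (by simpa using h))

theorem evaluates_feed_true (w : Str)
    (h : Evaluates (twiceTM M ei eo) (liftCfg (afterRun M) (true, none) (twiceStk z o u [] y)
      (initList M ((true :: (x.reverse ++ w)).map ei.symm))) t d) :
    Evaluates (twiceTM M ei eo) (twiceCfg (.feed true) r z o u x y
      (update (fun _ => []) M.k₀ (w.map ei.symm))) (t + x.length + 1) d := by
  induction x generalizing r w with
  | nil =>
    refine evaluates_twice ei eo ?_ h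
    simp [initList_eq, liftCfg]
  | cons a x ih =>
    refine evaluates_twice ei eo ?_ (ih (r := (r.1, some a)) (a :: w) (by simpa using h))
    simp [twiceCfg]

theorem evaluates_feed_false (w : Str)
    (h : Evaluates (twiceTM M ei eo) (liftCfg (afterRun M) (false, none) (twiceStk z o u x [])
      (initList M ((false :: (y.reverse ++ w)).map ei.symm))) t d) :
    Evaluates (twiceTM M ei eo) (twiceCfg (.feed false) r z o u x y
      (update (fun _ => []) M.k₀ (w.map ei.symm))) (t + y.length + 1) d := by
  induction y generalizing r w with
  | nil =>
    refine evaluates_twice ei eo ?_ h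
    simp [initList_eq, liftCfg]
  | cons a x ih =>
    refine evaluates_twice ei eo ?_ (ih (r := (r.1, some a)) (a :: w) (by simpa using h))
    simp [twiceCfg]

theorem evaluates_drain (b : Bool) (w : Str)
    (h : ∀ r, Evaluates (twiceTM M ei eo) (twiceCfg (.emit b) r z o (w.reverse ++ u) x y
      fun _ => []) t d) :
    Evaluates (twiceTM M ei eo) (twiceCfg (.drain b) r z o u x y
      (update (fun _ => []) M.k₁ (w.map eo.symm))) (t + w.length + 1) d := by
  induction w generalizing r u with
  | nil => exact evaluates_twice ei eo (by simp [twiceCfg]) (h (r.1, none))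
  | cons a w ih =>
    exact evaluates_twice ei eo (by simp [twiceCfg])
      (ih (r := (r.1, some a)) (u := a :: u) (by simpa using h))

theorem double_append (x y : Str) : double (x ++ y) = double x ++ double y := by
  simp [double]

theorem evaluates_emit_true
    (h : ∀ r, Evaluates (twiceTM M ei eo) (twiceCfg (.feed false) r z
      (false :: true :: (double u.reverse ++ o)) [] x y S) t d) :
    Evaluates (twiceTM M ei eo) (twiceCfg (.emit true) r z o u x y S) (t + u.length + 1) d := by
  induction u generalizing r o with
  | nil => exact evaluates_twice ei eo (by simp [twiceCfg]) (h (r.1, none))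
  | cons a w ih =>
    exact evaluates_twice ei eo (by simp [twiceCfg])
      (ih (r := (r.1, some a)) (o := a :: a :: o) (by simpa [double_append] using h))

theorem evaluates_emit_false
    (h : Evaluates (twiceTM M ei eo) (⟨none, ((true, none), M.initialState),
      join (twiceStk z (double u.reverse ++ o) [] x y) S⟩ : TwiceCfg M) t d) :
    Evaluates (twiceTM M ei eo) (twiceCfg (.emit false) r z o u x y S) (t + u.length + 1) d := by
  induction u generalizing r o with
  | nil => exact evaluates_twice ei eo (by simp) h
  | cons a w ih =>
    exact evaluates_twice ei eo (by simp [twiceCfg])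
      (ih (r := (r.1, some a)) (o := a :: a :: o) (by simpa [double_append] using h))

/-- A bound on the length of the output of a run of `M` on an input of length `n + 1`. -/
noncomputable def outputBound (M : FinTM2) (p : Polynomial ℕ) : Polynomial ℕ :=
  Polynomial.X + 1 + p.comp (Polynomial.X + 1) * Polynomial.C (∑ l, pushes (M.m l))

/-- A bound on the running time of `twiceTM` if that of `M` is `p`. -/
noncomputable def twiceTime (M : FinTM2) (p : Polynomial ℕ) : Polynomial ℕ :=
  3 * (Polynomial.X + 1) + 2 * (p.comp (Polynomial.X + 1) + 2 * (outputBound M p + 1))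

/-- The output stack is filled from the bottom, so the run on `true :: w` comes first. A run ends in
`haltList`, with the initial state and only the output stack possibly nonempty; once that stack is
drained, `M` is ready for the second run. -/
theorem evaluates_twiceTM {p : Polynomial ℕ} {f : Str → Str}
    (hf : ∀ w : Str, Evaluates M (initList M (w.map ei.symm)) (p.eval w.length)
      (haltList M ((f w).map eo.symm))) (w : Str) :
    Evaluates (twiceTM M ei eo) (twiceCfg .split (true, none) w [] [] [] [] fun _ => [])
      ((twiceTime M p).eval w.length)
      (⟨none, ((true, none), M.initialState),
        join (twiceStk [] (pair (f (false :: w)) (f (true :: w))) [] [] []) fun _ => []⟩ :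
          TwiceCfg M) := by
  obtain ⟨m, hm, hm'⟩ := hf (true :: w)
  obtain ⟨n, hn, hn'⟩ := hf (false :: w)
  have hlen : ∀ b k, k ≤ p.eval (b :: w).length →
      (flip bind M.step)^[k] (some (initList M ((b :: w).map ei.symm))) =
        some (haltList M ((f (b :: w)).map eo.symm)) →
      (f (b :: w)).length ≤ (outputBound M p).eval w.length := by
    intro b k hk h
    have h₁ := length_iterate_step_le k M.k₁ h
    have h₂ : ((initList M ((b :: w).map ei.symm)).stk M.k₁).length ≤ w.length + 1 := by
      rw [initList_eq]
      change (update (fun _ => []) M.k₀ _ M.k₁).length ≤ _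
      rcases eq_or_ne M.k₁ M.k₀ with e | e
      -- The input and output stacks of `M` may coincide. A variable `k` stands in for `M.k₁` so
      -- that the equation can be substituted.
      · have : ∀ (k : M.K) (s : List (M.Γ M.k₀)), k = M.k₀ →
            (update (fun k => ([] : List (M.Γ k))) M.k₀ s k).length ≤ s.length := by
          rintro k s rfl
          simp
        simpa using this M.k₁ ((b :: w).map ei.symm) e
      · simp [e]
    have h₃ : ((haltList M ((f (b :: w)).map eo.symm)).stk M.k₁).length = (f (b :: w)).length := by
      rw [haltList_eq]
      change (update (fun _ => []) M.k₁ _ M.k₁).length = _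
      simp
    have h₄ := Nat.mul_le_mul_right (∑ l, pushes (M.m l)) hk
    simp only [outputBound, Polynomial.eval_add, Polynomial.eval_X, Polynomial.eval_one,
      Polynomial.eval_mul, Polynomial.eval_comp, Polynomial.eval_C]
    rw [List.length_cons] at h₄
    omega
  have hlt := hlen true m hm hm'
  have hlf := hlen false n hn hn'
  have hempty : (fun k => ([] : List (M.Γ k))) =
      update (fun _ => []) M.k₀ (([] : Str).map ei.symm) := by simp
  have hpair : pair (f (false :: w)) (f (true :: w)) =
      double ((f (false :: w)).reverse ++ []).reverse ++
        (false :: true :: (double ((f (true :: w)).reverse ++ []).reverse ++ [])) := by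
    simp [pair_eq]
  rw [hpair]
  -- This shields the empty stacks of the target configuration from rewriting by `hempty`.
  generalize hd : TM2.Cfg.mk _ _ _ = d
  -- The time is listed from the last phase back to the first. Splitting and the two feedings give
  -- the `3 * (X + 1)` of `twiceTime`; each run adds its own time, one draining and one emission.
  refine Evaluates.mono (evaluates_split ei eo (t := 0 + ((f (false :: w)).reverse ++ []).length + 1 +
    (f (false :: w)).length + 1 + n + (w.reverse ++ []).length + 1 +
    ((f (true :: w)).reverse ++ []).length + 1 + (f (true :: w)).length + 1 + m +
    (w.reverse ++ []).length + 1) fun r => ?_) ?_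
  · rw [hempty]
    refine evaluates_feed_true ei eo [] (evaluates_liftCfg ei eo _ _ m (by simpa using hm') ?_)
    rw [haltList_eq]
    refine evaluates_drain ei eo true (f (true :: w)) fun r => evaluates_emit_true ei eo fun r => ?_
    rw [hempty]
    refine evaluates_feed_false ei eo [] (evaluates_liftCfg ei eo _ _ n (by simpa using hn') ?_)
    rw [haltList_eq]
    exact evaluates_drain ei eo false (f (false :: w)) fun r => evaluates_emit_false ei eo
      ⟨0, le_refl 0, congrArg some hd⟩
  · simp only [twiceTime, Polynomial.eval_add, Polynomial.eval_X, Polynomial.eval_one,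
      Polynomial.eval_mul, Polynomial.eval_comp, Polynomial.eval_ofNat, List.length_append,
      List.length_reverse, List.length_nil, List.length_cons] at hm hn ⊢
    omega

end

theorem polyTime_pair_cons {f : Str → Str} (hf : PolyTime f) :
    PolyTime fun w => pair (f (false :: w)) (f (true :: w)) := by
  obtain ⟨⟨⟨M, ei, eo⟩, p, h⟩⟩ := hf
  have hf : ∀ w : Str, Evaluates M (initList M (w.map ei.symm)) (p.eval w.length)
      (haltList M ((f w).map eo.symm)) := fun w =>
    ⟨(h w).steps, (h w).steps_le_m, (h w).evals_in_steps⟩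
  refine ⟨⟨⟨twiceTM M ei eo, Equiv.refl Bool, Equiv.refl Bool⟩, twiceTime M p, fun w => ?_⟩⟩
  have hw := evaluates_twiceTM ei eo hf w
  refine ⟨⟨hw.choose, ?_⟩, hw.choose_spec.1⟩
  have e₁ : initList (twiceTM M ei eo) (w.map (Equiv.refl Bool).symm) =
      twiceCfg .split (true, none) w [] [] [] [] fun _ => [] := by
    rw [initList_eq]
    refine congrArg (TM2.Cfg.mk _ _) ?_
    funext k
    rcases k with (_ | _ | _ | _ | _) | k
    · exact (update_self ..).trans (List.map_id _)
    all_goals rfl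
  have e₂ : haltList (twiceTM M ei eo)
      ((pair (f (false :: w)) (f (true :: w))).map (Equiv.refl Bool).symm) =
      (⟨none, ((true, none), M.initialState),
        join (twiceStk [] (pair (f (false :: w)) (f (true :: w))) [] [] []) fun _ => []⟩ :
          TwiceCfg M) := by
    rw [haltList_eq]
    refine congrArg (TM2.Cfg.mk _ _) ?_
    funext k
    rcases k with (_ | _ | _ | _ | _) | k
    · rfl
    · exact (update_self ..).trans (List.map_id _)
    all_goals rfl
  exact (congrArg (fun c => (flip bind (twiceTM M ei eo).step)^[hw.choose] (some c)) e₁).trans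
    (hw.choose_spec.2.trans (congrArg some e₂.symm))

end KernelRed

theorem mainTheorem11 (R : Setoid (List Bool)) (hR : KernelRed.NPEqComplete R) :
    KernelRed.NPComplete (KernelRed.inducedLang R) := by
  refine ⟨hR.1, fun A hA => ?_⟩
  obtain ⟨f, hf, h⟩ := hR.2 _ (KernelRed.inNP_inducedLang_headSetoid hA)
  refine ⟨_, KernelRed.polyTime_pair_cons hf, fun w => ?_⟩
  -- The hypothesis left to `decide` is that the two prepended symbols differ.
  rw [KernelRed.pair_mem_inducedLang, ← h, KernelRed.headSetoid_cons (by decide)]
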